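/- \begin{theorem} Let $K/F$ be a cyclic Galois field extension of degree $n$ with Galois group generated by $\sigma$, let $R=K[t;\sigma]$ be the skew polynomial ring with $ta=\sigma(a)t$ for $a\in K$, and let $2\le m\le n$. For $f\in R$ of degree $m$ let $R/Rf$ be the Petit algebra of $f$, that is, the set $\{x\in R : \deg x<m\}$ with the addition of $R$ and with the multiplication $x\circ y$ defined as the remainder of $xy$ upon right division by $f$ (that is, $xy=qf+x\circ y$ with $q\in R$, $\deg(x\circ y)<m$); scalars from $F$ act by left multiplication. The minimal central left multiple of $f$ is $\mathrm{mclm}(f)=\hat h(t^n)$, where $\hat h\in F[x]$ is the monic polynomial of least degree such that $\hat h(t^n)\in Rf$. Let $\mathrm{Aut}(K)_\sigma=\{\tau\in\mathrm{Aut}(K) : \tau\sigma=\sigma\tau\}$ (each such $\tau$ satisfies $\tau(F)=F$) and let $G=N_{K/F}(K^\times)\rtimes\mathrm{Aut}(K)_\sigma$ act on the monic irreducible polynomials of $F[x]$ by $$\hat h^{(\lambda,\tau)}(x)=\lambda^{-\deg \hat h}\,\hat h^{\tau}(\lambda x),$$ where $\hat h^\tau$ is obtained from $\hat h$ by applying $\tau$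 to the coefficients. Let $c,d\in K$ be such that $f(t)=t^m-c$ and $g(t)=t^m-d$ are irreducible in $R$, with minimal central left multiples $\mathrm{mclm}(f)=\hat h(t^n)$ and $\mathrm{mclm}(g)=\hat s(t^n)$. Suppose that either $n>m$ and $c\in K\setminus F$, or $n=m$ and $c$ lies in no field $E$ with $F\subseteq E\subsetneq K$. If $\hat s=\hat h^{(\lambda,\tau)}$ for some $(\lambda,\tau)\in G$, then neither of the algebras $R/R(t^m-c)$ and $R/R(t^m-d)$ is associative, and they are isomorphic: there is an isomorphism of nonassociative rings $$\Phi: R/R(t^m-c)\longrightarrow R/R(t^m-d)\quad\text{with}\quad \Phi(ax)=\tau(a)\Phi(x)\ \text{ for all } a\in F,\ x\in R/R(t^m-c);$$ in particular $\Phi$ is an isomorphism of nonassociative algebras over $F_0=\{a\in F : \tau(a)=a\}$. \end{theorem} -/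

import Mathlib

/-!
Skew polynomials are Mathlib's `SkewPolynomial K`, with `X * C a = C (φ a) * X`, where `φ` is the
endomorphism of `K` given by the action of `Multiplicative ℕ` on `K`.
-/

namespace PetitAlg

noncomputable section

section Division

variable {K : Type*} [Field K]

/-- The degree of a skew polynomial (with value `0` at `0`). -/
def natDegree (f : SkewPolynomial K) : ℕ := f.support.sup id

/-- The `K`-space of all skew polynomials of degree less than `m` (with `deg 0 = -∞`). -/
def degreeLT (K : Type*) [Field K] (m : ℕ) : Submodule K (SkewPolynomial K) where
  carrier := {g | ∀ i, m ≤ i → g.coeff i = 0}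
  add_mem' {a b} ha hb i hi := by simp [ha i hi, hb i hi]
  zero_mem' i _ := by simp
  smul_mem' c g hg i hi := by
    have h : (c • g).coeff i = c * g.coeff i := rfl
    rw [h, hg i hi, mul_zero]

lemma mem_degreeLT {m : ℕ} {g : SkewPolynomial K} :
    g ∈ degreeLT K m ↔ ∀ i, m ≤ i → g.coeff i = 0 := Iff.rfl

lemma coeff_eq_zero_of_natDegree_lt {f : SkewPolynomial K} {i : ℕ} (h : natDegree f < i) :
    f.coeff i = 0 := by
  by_contra hi
  exact absurd (Finset.le_sup (f := id) (SkewPolynomial.mem_support_iff.2 hi)) (not_le.2 h)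

lemma coeff_natDegree_ne_zero {f : SkewPolynomial K} (hf : f ≠ 0) : f.coeff (natDegree f) ≠ 0 := by
  have hne : f.support.Nonempty := by
    rw [Finset.nonempty_iff_ne_empty]
    simpa using hf
  obtain ⟨i, hi, h⟩ := Finset.exists_mem_eq_sup f.support hne id
  have h' : natDegree f = i := h
  rw [h']
  exact SkewPolynomial.mem_support_iff.1 hi

variable [MulSemiringAction (Multiplicative ℕ) K]

lemma coeff_mul (p q : SkewPolynomial K) (N : ℕ) :
    (p * q).coeff N = ∑ x ∈ Finset.HasAntidiagonal.antidiagonal N,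
      p.coeff x.1 * (Multiplicative.ofAdd x.1) • q.coeff x.2 :=
  SkewMonoidAlgebra.coeff_mul_antidiagonal_of_finset p q (Multiplicative.ofAdd N)
    (Finset.HasAntidiagonal.antidiagonal N : Finset (ℕ × ℕ))
    (fun {x} => Finset.HasAntidiagonal.mem_antidiagonal (A := ℕ) (n := N) (a := x))

/-- The top coefficient of a product. -/
lemma coeff_mul_add {p q : SkewPolynomial K} {a b : ℕ} (hp : ∀ i, a < i → p.coeff i = 0)
    (hq : ∀ i, b < i → q.coeff i = 0) :
    (p * q).coeff (a + b) = p.coeff a * (Multiplicative.ofAdd a) • q.coeff b := by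
  rw [coeff_mul, Finset.sum_eq_single (a, b)]
  · rintro ⟨i, j⟩ hij hne
    rw [Finset.HasAntidiagonal.mem_antidiagonal] at hij
    rcases lt_trichotomy i a with h | h | h
    · simp [hq j (by simp at hij; omega)]
    · exact absurd (Prod.ext h (by simp at hij ⊢; omega)) hne
    · simp [hp i h]
  · intro h
    exact absurd ((Finset.HasAntidiagonal.mem_antidiagonal (A := ℕ) (n := a + b) (a := (a, b))).2 rfl) h

lemma coeff_mul_eq_zero {p q : SkewPolynomial K} {a b N : ℕ} (hp : ∀ i, a < i → p.coeff i = 0)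
    (hq : ∀ i, b < i → q.coeff i = 0) (hN : a + b < N) : (p * q).coeff N = 0 := by
  rw [coeff_mul]
  refine Finset.sum_eq_zero ?_
  rintro ⟨i, j⟩ hij
  rw [Finset.HasAntidiagonal.mem_antidiagonal] at hij
  rcases lt_or_ge a i with h | h
  · simp [hp i h]
  · simp [hq j (by simp at hij; omega)]

/-- Right division by a nonzero skew polynomial: existence. -/
theorem exists_rightDivision {f : SkewPolynomial K} (hf : f ≠ 0) (g : SkewPolynomial K) :
    ∃ r ∈ degreeLT K (natDegree f), ∃ q, g = q * f + r := by
  suffices H : ∀ N : ℕ, ∀ g : SkewPolynomial K, g ∈ degreeLT K N →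
      ∃ r ∈ degreeLT K (natDegree f), ∃ q, g = q * f + r from
    H (natDegree g + 1) g fun i hi => coeff_eq_zero_of_natDegree_lt (Nat.lt_of_succ_le hi)
  intro N
  induction N with
  | zero => exact fun g hg => ⟨g, fun i _ => hg i (Nat.zero_le i), 0, by simp⟩
  | succ N ih =>
    intro g hg
    rcases lt_or_ge N (natDegree f) with hN | hN
    · exact ⟨g, fun i hi => hg i (by omega), 0, by simp⟩
    obtain ⟨k, rfl⟩ : ∃ k, N = k + natDegree f := ⟨N - natDegree f, by omega⟩
    have hfi : ∀ i, natDegree f < i → f.coeff i = 0 := fun i hi => coeff_eq_zero_of_natDegree_lt hi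
    set u : K := (Multiplicative.ofAdd k) • f.coeff (natDegree f) with hu
    have hu0 : u ≠ 0 := by
      rw [hu]
      exact fun h => coeff_natDegree_ne_zero hf
        ((map_eq_zero (MulSemiringAction.toRingHom (Multiplicative ℕ) K
          (Multiplicative.ofAdd k))).1 h)
    set q₀ : SkewPolynomial K :=
      SkewPolynomial.monomial k (g.coeff (k + natDegree f) * u⁻¹) with hq₀
    have hq₀i : ∀ i, k < i → q₀.coeff i = 0 := fun i hi => by
      rw [hq₀, SkewPolynomial.coeff_monomial, if_neg (by omega)]
    obtain ⟨r, hr, q, hq⟩ := ih (g - q₀ * f) (fun i hi => by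
      rw [SkewPolynomial.coeff_sub]
      rcases Nat.eq_or_lt_of_le hi with h | h
      · rw [← h, coeff_mul_add hq₀i hfi, hq₀, SkewPolynomial.coeff_monomial, if_pos rfl, ← hu,
          mul_assoc, inv_mul_cancel₀ hu0, mul_one, sub_self]
      · rw [hg i h, coeff_mul_eq_zero hq₀i hfi h, sub_zero])
    exact ⟨r, hr, q + q₀, by rw [add_mul, add_right_comm, ← hq, sub_add_cancel]⟩

/-- Right division by a nonzero skew polynomial: uniqueness. -/
theorem rightDivision_unique {f : SkewPolynomial K} (hf : f ≠ 0) {q q' r r' : SkewPolynomial K}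
    (hr : r ∈ degreeLT K (natDegree f)) (hr' : r' ∈ degreeLT K (natDegree f))
    (h : q * f + r = q' * f + r') : q = q' ∧ r = r' := by
  have h1 : (q - q') * f = r' - r := by
    rw [sub_mul]
    exact sub_eq_sub_iff_add_eq_add.2 (by rw [h, add_comm])
  have h2 : q - q' = 0 := by
    by_contra hne
    have h3 := coeff_mul_add (p := q - q') (q := f)
      (fun i hi => coeff_eq_zero_of_natDegree_lt hi) (fun i hi => coeff_eq_zero_of_natDegree_lt hi)
    rw [h1, (degreeLT K (natDegree f)).sub_mem hr' hr _ (Nat.le_add_left _ _)] at h3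
    rcases mul_eq_zero.1 h3.symm with h4 | h4
    · exact coeff_natDegree_ne_zero hne h4
    · exact coeff_natDegree_ne_zero hf
        ((map_eq_zero (MulSemiringAction.toRingHom (Multiplicative ℕ) K _)).1 h4)
  refine ⟨sub_eq_zero.1 h2, ?_⟩
  rw [h2, zero_mul] at h1
  exact (sub_eq_zero.1 h1.symm).symm

open Classical in
/-- The remainder `g mod_r f` of `g` upon right division by `f`, i.e. the unique `r` of degree
less than `deg f` with `g = q * f + r` for some `q` (and `0` if `f = 0`). -/
def rem (f g : SkewPolynomial K) : SkewPolynomial K :=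
  if hf : f = 0 then 0 else (exists_rightDivision hf g).choose

lemma rem_zero_left (g : SkewPolynomial K) : rem 0 g = 0 := dif_pos rfl

lemma rem_mem (f g : SkewPolynomial K) : rem f g ∈ degreeLT K (natDegree f) := by
  by_cases hf : f = 0
  · rw [hf, rem_zero_left]
    exact Submodule.zero_mem _
  · rw [rem, dif_neg hf]
    exact (exists_rightDivision hf g).choose_spec.1

lemma exists_eq_add_rem {f : SkewPolynomial K} (hf : f ≠ 0) (g : SkewPolynomial K) :
    ∃ q, g = q * f + rem f g := by
  rw [rem, dif_neg hf]
  exact (exists_rightDivision hf g).choose_spec.2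

lemma rem_eq {f g q r : SkewPolynomial K} (hf : f ≠ 0) (hr : r ∈ degreeLT K (natDegree f))
    (h : g = q * f + r) : rem f g = r := by
  obtain ⟨q', h'⟩ := exists_eq_add_rem hf g
  exact (rightDivision_unique hf (rem_mem f g) hr (h'.symm.trans h)).2

lemma rem_add (f g h : SkewPolynomial K) : rem f (g + h) = rem f g + rem f h := by
  by_cases hf : f = 0
  · subst hf; simp [rem_zero_left]
  obtain ⟨q, hq⟩ := exists_eq_add_rem hf g
  obtain ⟨q', hq'⟩ := exists_eq_add_rem hf h
  refine rem_eq (q := q + q') hf (Submodule.add_mem _ (rem_mem f g) (rem_mem f h)) ?_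
  rw [add_mul, add_add_add_comm, ← hq, ← hq']

lemma rem_zero (f : SkewPolynomial K) : rem f 0 = 0 := by
  have h := rem_add f 0 0
  rwa [add_zero, left_eq_add] at h

lemma rem_of_mem {f g : SkewPolynomial K} (hg : g ∈ degreeLT K (natDegree f)) : rem f g = g := by
  by_cases hf : f = 0
  · subst hf
    rw [rem_zero_left]
    exact SkewPolynomial.ext fun i => (hg i (by simp [natDegree])).symm
  · exact rem_eq (q := 0) hf hg (by simp)

lemma rem_one_mul_of_mem {f g : SkewPolynomial K} (hg : g ∈ degreeLT K (natDegree f)) :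
    rem f (rem f 1 * g) = g ∧ rem f (g * rem f 1) = g := by
  rcases Nat.eq_zero_or_pos (natDegree f) with h0 | h0
  · have hz : g = 0 := SkewPolynomial.ext fun i => hg i (by omega)
    subst hz
    simp [rem_zero]
  · have h1 : rem f 1 = 1 := rem_of_mem fun i hi => by
      rw [SkewPolynomial.coeff_one, if_neg (by omega)]
    rw [h1, one_mul, mul_one]
    exact ⟨rem_of_mem hg, rem_of_mem hg⟩

end Division

/-! ### Petit algebras -/

/-- The Petit algebra `R/Rf` (also written `S_f`), where `R` is the skew polynomial ring: the set
`{g ∈ R | deg g < deg f}` with the addition of polynomials and with the multiplication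
`g ∘ h = g h mod_r f`. Its unit is the residue of `1`, which is `1` as soon as `deg f ≥ 1`. -/
def PetitAlgebra {K : Type*} [Field K] (f : SkewPolynomial K) : Type _ :=
  ↥(degreeLT K (natDegree f))

namespace PetitAlgebra

variable {K : Type*} [Field K] {f : SkewPolynomial K}

/-- The underlying polynomial of degree less than `deg f`. -/
def val (x : PetitAlgebra f) : SkewPolynomial K := Subtype.val x

instance : AddCommGroup (PetitAlgebra f) :=
  inferInstanceAs (AddCommGroup ↥(degreeLT K (natDegree f)))

/-- Left multiplication by constants makes `R/Rf` a left `K`-vector space. -/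
instance : Module K (PetitAlgebra f) :=
  inferInstanceAs (Module K ↥(degreeLT K (natDegree f)))

lemma val_mem (x : PetitAlgebra f) : x.val ∈ degreeLT K (natDegree f) := Subtype.property x

lemma val_injective : Function.Injective (val : PetitAlgebra f → SkewPolynomial K) :=
  Subtype.val_injective

lemma val_add (x y : PetitAlgebra f) : (x + y).val = x.val + y.val := rfl

lemma val_zero : (0 : PetitAlgebra f).val = 0 := rfl

lemma val_smul (a : K) (x : PetitAlgebra f) : (a • x).val = a • x.val := rfl

variable [MulSemiringAction (Multiplicative ℕ) K]

/-- The residue of a skew polynomial in `R/Rf`. -/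
def mk (f : SkewPolynomial K) (g : SkewPolynomial K) : PetitAlgebra f := ⟨rem f g, rem_mem f g⟩

lemma val_mk (g : SkewPolynomial K) : (mk f g).val = rem f g := rfl

instance : Mul (PetitAlgebra f) := ⟨fun x y => mk f (x.val * y.val)⟩

instance : One (PetitAlgebra f) := ⟨mk f 1⟩

lemma val_mul (x y : PetitAlgebra f) : (x * y).val = rem f (x.val * y.val) := rfl

lemma val_one : (1 : PetitAlgebra f).val = rem f 1 := rfl

/-- `R/Rf` is a unital nonassociative ring. -/
instance : NonAssocRing (PetitAlgebra f) where
  left_distrib x y z := val_injective (by simp only [val_mul, val_add, mul_add, rem_add])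
  right_distrib x y z := val_injective (by simp only [val_mul, val_add, add_mul, rem_add])
  zero_mul x := val_injective (by simp only [val_mul, val_zero, zero_mul, rem_zero])
  mul_zero x := val_injective (by simp only [val_mul, val_zero, mul_zero, rem_zero])
  one_mul x := val_injective (rem_one_mul_of_mem x.val_mem).1
  mul_one x := val_injective (rem_one_mul_of_mem x.val_mem).2

end PetitAlgebra

/-- A nonassociative ring is proper if it is not associative. -/
def IsProperNonassociative (A : Type*) [NonAssocRing A] : Prop :=
  ¬ ∀ x y z : A, (x * y) * z = x * (y * z)

/-! ### Minimal central left multiples and the group action -/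

section Orbits

variable {F K : Type*} [Field F] [Field K] [Algebra F K]

/-- The polynomial `h(t^n)` in the skew polynomial ring over `K`, for `h(x) ∈ F[x]`. -/
def evalPow (K : Type*) [Field K] [Algebra F K] (n : ℕ) (h : Polynomial F) : SkewPolynomial K :=
  h.sum fun i a => SkewPolynomial.monomial (n * i) (algebraMap F K a)

/-- `h(t^n)` is the minimal central left multiple of `f`: the polynomial `h ∈ F[x]` is monic,
`h(t^n) = g f` for some `g`, and `h` has the least degree among all monic polynomials with
this property. Here `F[t^n]` is the centre of the skew polynomial ring. -/
def IsMclm [MulSemiringAction (Multiplicative ℕ) K] (n : ℕ) (f : SkewPolynomial K)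
    (h : Polynomial F) : Prop :=
  h.Monic ∧ (∃ g, evalPow K n h = g * f) ∧
    ∀ p : Polynomial F, p.Monic → (∃ g, evalPow K n p = g * f) → h.natDegree ≤ p.natDegree

/-- The group `Aut(K)_σ` of all field automorphisms of `K` that commute with `σ`. -/
def autCommuting (σ : K ≃ₐ[F] K) : Subgroup (RingAut K) :=
  Subgroup.centralizer {(σ.toRingEquiv : RingAut K)}

/-- The group `N_{K/F}(K^×)` of nonzero norms. -/
def normGroup (F K : Type*) [Field F] [Field K] [Algebra F K] : Subgroup Fˣ :=
  (Units.map (Algebra.norm F : K →* F)).range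

/-- The polynomial `h^{(lam,τ)}(x) = lam^{-d} h^τ(lam x)`, `d = deg h`, where `h^τ` arises from
`h ∈ F[x]` by applying `τ` to the coefficients. It is written as an element of `K[x]`; it has
coefficients in `F` when `τ` commutes with a generator of `Gal(K/F)`. -/
def twist (lam : F) (τ : RingAut K) (h : Polynomial F) : Polynomial K :=
  Polynomial.C ((algebraMap F K lam)⁻¹ ^ h.natDegree) *
    ((h.map (algebraMap F K)).map (τ : K →+* K)).comp
      (Polynomial.C (algebraMap F K lam) * Polynomial.X)

end Orbits

end

end PetitAlg

/-! Write `N_i(b) = b σ(b) ⋯ σ^(i-1)(b)`. If `ρ` commutes with `σ`, then `a ↦ ρ(a)`, `t ↦ bt` is an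
endomorphism of `R` sending `t^i` to `N_i(b) t^i`. So if `ρ(c) = N_m(b) d` with `b ≠ 0`, it sends
`t^m - c` to `N_m(b)(t^m - d)` and induces an isomorphism of Petit algebras. It remains to find `ρ`
and `b`, with `ρ = τ` on `F`.

Let `θ = σ^m` have order `r`, and let `mr = nk`. Modulo the left ideal `R(t^m - c)`, the power
`t^(nk)` is the constant `γ = c θ(c) ⋯ θ^(r-1)(c)`. Hence `ĥ` divides `μ_γ(x^k)`, where `μ_γ` is the
minimal polynomial of `γ` over `F`; likewise `ŝ` divides `μ_δ(x^k)`, with `δ` built from `d`. A root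
`α` of `ŝ` yields the root `λα` of `ĥ^τ`, and comparing `k`-th powers shows that `λ^k δ` and `τ(γ)`
agree up to Galois conjugation (`exists_conj_of_twist`). Absorbing the conjugations into `τ` gives
`ρ`.

If `λ` is the norm of `a`, then `λ^k = N_(nk)(a)` is the `θ`-norm of `N_m(a)`. Thus `ρ(c)` and
`N_m(a) d` have equal `θ`-norms. By Hilbert 90 their quotient is `θ(u)/u = N_m(σ(u)/u)`, so `b = a
σ(u)/u` works (`exists_eq_skewNorm_mul`).

Associativity is excluded by associators of monomials, which would force `σ^m = 1` (as `c ≠ 0`) and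
`σ(c) = c`. -/

namespace PetitAlg

/-! ### Skew norms, Hilbert 90 and conjugates -/

section SkewNorm

variable {F K : Type*} [Field F] [Field K] [Algebra F K]

/-- The skew norm `a * σ a * ⋯ * σ^(k-1) a`. -/
def skewNorm (σ : K ≃ₐ[F] K) (k : ℕ) (a : K) : K := ∏ i ∈ Finset.range k, (σ ^ i) a

lemma skewNorm_zero (σ : K ≃ₐ[F] K) (a : K) : skewNorm σ 0 a = 1 := rfl

lemma skewNorm_one (σ : K ≃ₐ[F] K) (a : K) : skewNorm σ 1 a = a := by simp [skewNorm]

lemma skewNorm_add (σ : K ≃ₐ[F] K) (i j : ℕ) (a : K) :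
    skewNorm σ (i + j) a = skewNorm σ i a * (σ ^ i) (skewNorm σ j a) := by
  simp only [skewNorm, Finset.prod_range_add, map_prod, pow_add, AlgEquiv.mul_apply]

lemma skewNorm_succ (σ : K ≃ₐ[F] K) (k : ℕ) (a : K) :
    skewNorm σ (k + 1) a = skewNorm σ k a * (σ ^ k) a := by
  rw [skewNorm_add, skewNorm_one]

lemma skewNorm_mul (σ : K ≃ₐ[F] K) (k : ℕ) (a b : K) :
    skewNorm σ k (a * b) = skewNorm σ k a * skewNorm σ k b := by
  simp only [skewNorm, map_mul, Finset.prod_mul_distrib]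

lemma skewNorm_inv (σ : K ≃ₐ[F] K) (k : ℕ) (a : K) :
    skewNorm σ k a⁻¹ = (skewNorm σ k a)⁻¹ := by
  simp only [skewNorm, map_inv₀, Finset.prod_inv_distrib]

lemma skewNorm_ne_zero (σ : K ≃ₐ[F] K) (k : ℕ) {a : K} (ha : a ≠ 0) : skewNorm σ k a ≠ 0 :=
  Finset.prod_ne_zero_iff.2 fun _ _ => (map_ne_zero_iff _ (AlgEquiv.injective _)).2 ha

lemma commute_pow_apply {σ : K ≃ₐ[F] K} {ρ : K ≃+* K} (hρ : ∀ a, ρ (σ a) = σ (ρ a)) (k : ℕ)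
    (a : K) : ρ ((σ ^ k) a) = (σ ^ k) (ρ a) := by
  induction k generalizing a with
  | zero => rfl
  | succ k ih => rw [pow_succ, AlgEquiv.mul_apply, AlgEquiv.mul_apply, ih, hρ]

lemma map_skewNorm {σ : K ≃ₐ[F] K} {ρ : K ≃+* K} (hρ : ∀ a, ρ (σ a) = σ (ρ a)) (k : ℕ) (a : K) :
    ρ (skewNorm σ k a) = skewNorm σ k (ρ a) := by
  simp only [skewNorm, map_prod, commute_pow_apply hρ]

/-- Transitivity of skew norms: the `mr` factors are grouped into `r` blocks of length `m`. -/
lemma skewNorm_pow_skewNorm (σ : K ≃ₐ[F] K) (m r : ℕ) (a : K) :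
    skewNorm (σ ^ m) r (skewNorm σ m a) = skewNorm σ (m * r) a := by
  induction r with
  | zero => rfl
  | succ r ih => rw [skewNorm_succ, ih, Nat.mul_succ, skewNorm_add, pow_mul]

lemma skewNorm_mul_of_pow_eq_one {σ : K ≃ₐ[F] K} {n : ℕ} (hσ : σ ^ n = 1) (k : ℕ) (a : K) :
    skewNorm σ (n * k) a = skewNorm σ n a ^ k := by
  induction k with
  | zero => rw [mul_zero, skewNorm_zero, pow_zero]
  | succ k ih =>
    rw [Nat.mul_succ, skewNorm_add, ih, pow_mul, hσ, one_pow, AlgEquiv.one_apply, pow_succ]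

/-- The skew norm of `σ u / u` telescopes. -/
lemma skewNorm_apply_div (σ : K ≃ₐ[F] K) (k : ℕ) {u : K} (hu : u ≠ 0) :
    skewNorm σ k (σ u * u⁻¹) = (σ ^ k) u * u⁻¹ := by
  induction k with
  | zero => simp [skewNorm_zero, hu]
  | succ k ih =>
    have h : (σ ^ k) u ≠ 0 := (map_ne_zero_iff _ (AlgEquiv.injective _)).2 hu
    rw [skewNorm_succ, ih, map_mul, ← AlgEquiv.mul_apply, ← pow_succ, map_inv₀]
    field_simp

/-- Hilbert's Theorem 90 for the cyclic group generated by an automorphism of finite order. -/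
theorem exists_eq_mul_apply_of_skewNorm_eq_one (θ : K ≃ₐ[F] K) (hθ : 0 < orderOf θ) {x : K}
    (hx : skewNorm θ (orderOf θ) x = 1) : ∃ u : K, u ≠ 0 ∧ x * θ u = u := by
  set r := orderOf θ with hr
  -- Powers of `θ` below its order are distinct characters, so by Dedekind some value of the
  -- resolvent sum is nonzero; its coefficient at `i = 0` is the empty product `1`.
  have hinj : Function.Injective fun i : Fin r => (((θ ^ (i : ℕ) : K ≃ₐ[F] K) : K →* K)) := by
    intro i j hij
    have h : θ ^ (i : ℕ) = θ ^ (j : ℕ) := AlgEquiv.ext fun a => DFunLike.congr_fun hij a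
    exact Fin.ext (pow_injOn_Iio_orderOf i.2 j.2 h)
  have hlin := (linearIndependent_monoidHom K K).comp _ hinj
  rw [Fintype.linearIndependent_iff] at hlin
  obtain ⟨y, hy⟩ : ∃ y : K, ∑ i ∈ Finset.range r, skewNorm θ i x * (θ ^ i) y ≠ 0 := by
    by_contra! H
    have h0 := hlin (fun i => skewNorm θ i x) (by
      funext y
      have := H y
      rw [Finset.sum_range] at this
      simpa using this) ⟨0, hθ⟩
    exact one_ne_zero h0
  refine ⟨_, hy, ?_⟩
  -- The map `z ↦ x θ(z)` shifts the summation index by one. The new term at `r` equals the lost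
  -- term at `0`, since `θ^r = 1` and the skew norm of `x` of length `r` is `1`.
  have hstep : ∀ i, x * θ (skewNorm θ i x * (θ ^ i) y) =
      skewNorm θ (i + 1) x * (θ ^ (i + 1)) y := fun i => by
    rw [add_comm, skewNorm_add, skewNorm_one, pow_add, pow_one, map_mul, AlgEquiv.mul_apply,
      mul_assoc]
  rw [map_sum, Finset.mul_sum, Finset.sum_congr rfl fun i _ => hstep i]
  have h1 := Finset.sum_range_succ (fun i => skewNorm θ i x * (θ ^ i) y) r
  rw [Finset.sum_range_succ', hx, hr, pow_orderOf_eq_one] at h1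
  simpa [skewNorm_zero] using h1

/-- Elements whose skew norms for `σ^m` agree up to that of a skew norm of length `m` differ by a
skew norm of length `m`. -/
theorem exists_eq_skewNorm_mul (σ : K ≃ₐ[F] K) (m : ℕ) (hθ : 0 < orderOf (σ ^ m)) {a c d : K}
    (ha : a ≠ 0) (hd : d ≠ 0)
    (h : skewNorm (σ ^ m) (orderOf (σ ^ m)) c =
      skewNorm (σ ^ m) (orderOf (σ ^ m)) (skewNorm σ m a * d)) :
    ∃ b : K, b ≠ 0 ∧ c = skewNorm σ m b * d := by
  have hne : skewNorm σ m a * d ≠ 0 := mul_ne_zero (skewNorm_ne_zero σ m ha) hd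
  obtain ⟨u, hu, hxu⟩ := exists_eq_mul_apply_of_skewNorm_eq_one (σ ^ m) hθ
    (x := skewNorm σ m a * d * c⁻¹) (by
      rw [skewNorm_mul, skewNorm_inv, h, mul_inv_cancel₀ (skewNorm_ne_zero _ _ hne)])
  -- With `c⁻¹ = 0` for `c = 0`, the Hilbert 90 relation would force `u = 0`.
  have hc : c ≠ 0 := by
    rintro rfl
    simp [hu.symm] at hxu
  refine ⟨a * (σ u * u⁻¹), mul_ne_zero ha (mul_ne_zero ?_ (inv_ne_zero hu)), ?_⟩
  · exact (map_ne_zero_iff _ (AlgEquiv.injective _)).2 hu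
  · rw [skewNorm_mul, skewNorm_apply_div σ m hu]
    field_simp at hxu ⊢
    linear_combination -hxu

/-- For a generator of the Galois group, the skew norm of full length is the norm. -/
theorem skewNorm_finrank [FiniteDimensional F K] [IsGalois F K] {σ : K ≃ₐ[F] K}
    (hσ : ∀ ρ : K ≃ₐ[F] K, ρ ∈ Subgroup.zpowers σ) (a : K) :
    skewNorm σ (Module.finrank F K) a = algebraMap F K (Algebra.norm F a) := by
  have hord : orderOf σ = Module.finrank F K := by
    rw [orderOf_eq_card_of_forall_mem_zpowers hσ, IsGalois.card_aut_eq_finrank]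
  rw [Algebra.norm_eq_prod_automorphisms, ← hord, skewNorm, Finset.prod_range]
  refine Fintype.prod_bijective (fun i : Fin (orderOf σ) => σ ^ (i : ℕ)) ?_ _ _ fun _ => rfl
  refine (Fintype.bijective_iff_injective_and_card _).2
    ⟨fun i j hij => Fin.ext (pow_injOn_Iio_orderOf i.2 j.2 hij), ?_⟩
  rw [Fintype.card_fin, hord, ← IsGalois.card_aut_eq_finrank, Nat.card_eq_fintype_card]

/-- A root of a transported minimal polynomial is the image of a conjugate. -/
theorem exists_algEquiv_of_eval₂_minpoly [FiniteDimensional F K] [IsGalois F K] {L : Type*}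
    [Field L] (ι : K →+* L) (x : K) {β : L}
    (h : (minpoly F x).eval₂ (ι.comp (algebraMap F K)) β = 0) :
    ∃ ρ : K ≃ₐ[F] K, β = ι (ρ x) := by
  have hint : IsIntegral F x := Algebra.IsIntegral.isIntegral x
  have hroot : (((minpoly F x).map (algebraMap F K)).map ι).IsRoot β := by
    rw [Polynomial.IsRoot.def, Polynomial.eval_map, Polynomial.eval₂_map]
    exact h
  have hne : (minpoly F x).map (algebraMap F K) ≠ 0 :=
    Polynomial.map_ne_zero (minpoly.ne_zero hint)
  -- Normality puts every root of the minimal polynomial in `K`, hence `β` in the image of `ι`.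
  obtain ⟨y, rfl⟩ := (IsGalois.splits F x).mem_range_of_isRoot hne hroot
  rw [← Polynomial.eval₂_map, Polynomial.eval₂_hom, map_eq_zero, Polynomial.eval_map_algebraMap]
    at h
  obtain ⟨ρ, hρ⟩ := isConjRoot_iff_exists_algEquiv.1
    ((isConjRoot_iff_aeval_eq_zero hint).2 h).symm
  exact ⟨ρ, by rw [hρ]⟩

end SkewNorm

end PetitAlg

namespace PetitAlg

/-! ### Left multiples of `t^m - c` and divisibility by the minimal central left multiple -/

section Skew

variable {F K : Type*} [Field F] [Field K] [Algebra F K] [MulSemiringAction (Multiplicative ℕ) K]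
  {σ : K ≃ₐ[F] K}

open SkewPolynomial

lemma phi_iterate (hφ : ∀ a : K, SkewPolynomial.φ a = σ a) (i : ℕ) (a : K) :
    (SkewPolynomial.φ : K →+* K)^[i] a = (σ ^ i) a := by
  induction i generalizing a with
  | zero => rfl
  | succ i ih => rw [Function.iterate_succ_apply, ih, hφ, pow_succ, AlgEquiv.mul_apply]

lemma ofAdd_smul (hφ : ∀ a : K, SkewPolynomial.φ a = σ a) (i : ℕ) (a : K) :
    Multiplicative.ofAdd i • a = (σ ^ i) a := by
  rw [← φ_iterate_apply, phi_iterate hφ]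

lemma X_pow_mul_C (hφ : ∀ a : K, SkewPolynomial.φ a = σ a) (i : ℕ) (a : K) :
    (X : SkewPolynomial K) ^ i * C a = C ((σ ^ i) a) * X ^ i := by
  rw [← monomial_zero_left, X_pow_mul_monomial, phi_iterate hφ, zero_add,
    C_mul_X_pow_eq_monomial]

/-- Modulo `t^m - c`, the powers of `t^m` are the skew norms of `c`. -/
lemma X_pow_sub_skewNorm_mem (hφ : ∀ a : K, SkewPolynomial.φ a = σ a) (m r : ℕ) (c : K) :
    (X : SkewPolynomial K) ^ (m * r) - C (skewNorm (σ ^ m) r c) ∈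
      Ideal.span {(X : SkewPolynomial K) ^ m - C c} := by
  induction r with
  | zero => simp [skewNorm_zero, C_1]
  | succ r ih =>
    -- The ideal is only a left ideal, so `t^m` multiplies from the left and passes the constant at
    -- the cost of `σ^m`.
    have h1 := Ideal.mul_mem_left _ ((X : SkewPolynomial K) ^ m) ih
    have h2 := Ideal.mul_mem_left _ (C ((σ ^ m) (skewNorm (σ ^ m) r c)))
      (Ideal.mem_span_singleton_self ((X : SkewPolynomial K) ^ m - C c))
    convert Ideal.add_mem _ h1 h2 using 1
    rw [mul_sub, mul_sub, X_pow_mul_C hφ, ← pow_add, ← C_mul, add_comm r 1, skewNorm_add,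
      skewNorm_one, pow_one, mul_comm c, Nat.mul_add, mul_one]
    abel

/-- Substitution of `t^n` as a ring homomorphism. -/
noncomputable def evalPowHom (hφ : ∀ a : K, SkewPolynomial.φ a = σ a) (n : ℕ) :
    Polynomial F →+* SkewPolynomial K :=
  Polynomial.eval₂RingHom' (CRingHom.comp (algebraMap F K)) (X ^ n) fun a => by
    -- Constants from `F` are fixed by `σ`, so they commute with `t^n`.
    have h := X_pow_mul_C hφ n (algebraMap F K a)
    rw [AlgEquiv.commutes] at h
    exact h.symm

lemma evalPowHom_apply (hφ : ∀ a : K, SkewPolynomial.φ a = σ a) (n : ℕ) (p : Polynomial F) :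
    evalPowHom hφ n p = evalPow K n p := by
  change p.eval₂ _ _ = _
  rw [Polynomial.eval₂_eq_sum, evalPow]
  refine Finset.sum_congr rfl fun i _ => ?_
  simp only [← pow_mul]
  exact C_mul_X_pow_eq_monomial (R := K) (n := n * i)

lemma evalPowHom_C (hφ : ∀ a : K, SkewPolynomial.φ a = σ a) (n : ℕ) (a : F) :
    evalPowHom hφ n (Polynomial.C a) = C (algebraMap F K a) :=
  Polynomial.eval₂_C _ _

lemma evalPowHom_X (hφ : ∀ a : K, SkewPolynomial.φ a = σ a) (n : ℕ) :
    evalPowHom hφ n (Polynomial.X : Polynomial F) = X ^ n :=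
  Polynomial.eval₂_X _ _

/-- Since `σ^n = 1`, the power `t^(nk)` commutes with constants, so a congruence `t^(nk) ≡ γ` modulo
a left ideal passes to powers and then to polynomials over `F`. Taking for `p` the minimal
polynomial of `γ` makes the constant vanish. -/
lemma evalPowHom_expand_sub_mem (hφ : ∀ a : K, SkewPolynomial.φ a = σ a) {n : ℕ}
    (hn : σ ^ n = 1) (k : ℕ) {f : SkewPolynomial K} {γ : K}
    (hγ : (X : SkewPolynomial K) ^ (n * k) - C γ ∈ Ideal.span {f}) (p : Polynomial F) :
    evalPowHom hφ n (Polynomial.expand F k p) - C (Polynomial.aeval γ p) ∈ Ideal.span {f} := by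
  have hpow : ∀ i : ℕ, (X : SkewPolynomial K) ^ (n * k * i) - C (γ ^ i) ∈ Ideal.span {f} := by
    intro i
    induction i with
    | zero => simp [C_1]
    | succ i ih =>
      have h1 := Ideal.mul_mem_left _ ((X : SkewPolynomial K) ^ (n * k)) ih
      have h2 := Ideal.mul_mem_left _ (C (γ ^ i)) hγ
      convert Ideal.add_mem _ h1 h2 using 1
      rw [mul_sub, mul_sub, X_pow_mul_C hφ, pow_mul σ, hn, one_pow, AlgEquiv.one_apply, ← pow_add,
        ← C_mul, pow_succ γ, mul_add, mul_one, add_comm (n * k * i)]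
      abel
  induction p using Polynomial.induction_on' with
  | add p q hp hq =>
    convert Ideal.add_mem _ hp hq using 1
    rw [map_add, map_add, map_add, map_add]
    abel
  | monomial i a =>
    convert Ideal.mul_mem_left _ (C (algebraMap F K a)) (hpow i) using 1
    rw [Polynomial.expand_monomial, ← Polynomial.C_mul_X_pow_eq_monomial, map_mul, map_pow,
      evalPowHom_C, evalPowHom_X, ← pow_mul, Polynomial.aeval_monomial, C_mul, mul_sub, mul_assoc,
      mul_comm k]

/-- The minimal central left multiple divides every polynomial whose value at `t^n` is a left
multiple. -/
theorem IsMclm.dvd (hφ : ∀ a : K, SkewPolynomial.φ a = σ a) {n : ℕ} {f : SkewPolynomial K}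
    {h : Polynomial F} (hh : IsMclm n f h) {p : Polynomial F}
    (hp : evalPowHom hφ n p ∈ Ideal.span {f}) : h ∣ p := by
  obtain ⟨hmon, ⟨q, hq⟩, hmin⟩ := hh
  rw [← Polynomial.modByMonic_eq_zero_iff_dvd hmon]
  by_contra hr
  have hlc : (p %ₘ h).leadingCoeff ≠ 0 := Polynomial.leadingCoeff_ne_zero.2 hr
  have hmem : evalPowHom hφ n (p %ₘ h) ∈ Ideal.span {f} := by
    rw [Polynomial.modByMonic_eq_sub_mul_div, mul_comm, map_sub, map_mul, evalPowHom_apply _ _ h]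
    exact Ideal.sub_mem _ hp (Ideal.mul_mem_left _ _ (Ideal.mem_span_singleton'.2 ⟨q, hq.symm⟩))
  -- Minimality is stated for monic polynomials only, so the remainder is normalised.
  have hmem' : evalPowHom hφ n (Polynomial.C (p %ₘ h).leadingCoeff⁻¹ * (p %ₘ h)) ∈
      Ideal.span {f} := by
    rw [map_mul]
    exact Ideal.mul_mem_left _ _ hmem
  obtain ⟨g, hg⟩ := Ideal.mem_span_singleton'.1 hmem'
  have hle := hmin _ (Polynomial.monic_C_mul_of_mul_leadingCoeff_eq_one (inv_mul_cancel₀ hlc))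
    ⟨g, by rw [← evalPowHom_apply hφ, hg]⟩
  rw [Polynomial.natDegree_C_mul (inv_ne_zero hlc)] at hle
  exact absurd (Polynomial.natDegree_lt_natDegree hr (Polynomial.degree_modByMonic_lt p hmon))
    (not_lt.2 hle)

/-- The minimal central left multiple of `t^m - c` divides the polynomial obtained from the
minimal polynomial of a skew norm of `c`. -/
theorem IsMclm.dvd_expand_minpoly (hφ : ∀ a : K, SkewPolynomial.φ a = σ a) {n m r k : ℕ}
    (hn : σ ^ n = 1) (hk : m * r = n * k) {c : K} {h : Polynomial F}
    (hh : IsMclm n (X ^ m - C c) h) :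
    h ∣ Polynomial.expand F k (minpoly F (skewNorm (σ ^ m) r c)) := by
  refine hh.dvd hφ ?_
  have h1 := X_pow_sub_skewNorm_mem hφ m r c
  rw [hk] at h1
  simpa using evalPowHom_expand_sub_mem hφ hn k h1
    (minpoly F (skewNorm (σ ^ m) r c))

lemma coeff_X_pow_sub_C (m : ℕ) (c : K) (i : ℕ) :
    ((X : SkewPolynomial K) ^ m - C c).coeff i =
      (if m = i then 1 else 0) - if i = 0 then c else 0 := by
  rw [coeff_sub, ← monomial_one_right_eq_X_pow, coeff_monomial, coeff_C]

lemma natDegree_X_pow_sub_C {m : ℕ} (hm : 0 < m) (c : K) :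
    natDegree ((X : SkewPolynomial K) ^ m - C c) = m := by
  apply le_antisymm
  · refine Finset.sup_le fun i hi => ?_
    by_contra hlt
    simp only [id, not_le] at hlt
    rw [mem_support_iff, coeff_X_pow_sub_C, if_neg (by omega), if_neg (by omega), sub_zero] at hi
    exact hi rfl
  · by_contra hlt
    have h := coeff_eq_zero_of_natDegree_lt (not_le.1 hlt)
    rw [coeff_X_pow_sub_C, if_pos rfl, if_neg (by omega), sub_zero] at h
    exact one_ne_zero h

lemma X_pow_sub_C_ne_zero {m : ℕ} (hm : 0 < m) (c : K) : (X : SkewPolynomial K) ^ m - C c ≠ 0 := by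
  intro h
  have h1 := natDegree_X_pow_sub_C hm c
  rw [h] at h1
  simp [natDegree] at h1
  omega

/-- An element with a left inverse has degree `0`. -/
lemma natDegree_eq_zero_of_mul_eq_one {p q : SkewPolynomial K} (h : q * p = 1) :
    natDegree p = 0 := by
  by_contra hp
  have hp0 : p ≠ 0 := by rintro rfl; simp [natDegree] at hp
  have hq0 : q ≠ 0 := by
    rintro rfl
    rw [zero_mul] at h
    have := congrArg (fun x : SkewPolynomial K => x.coeff 0) h
    simp at this
  have h1 := coeff_mul_add (p := q) (q := p) (fun i hi => coeff_eq_zero_of_natDegree_lt hi)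
    (fun i hi => coeff_eq_zero_of_natDegree_lt hi)
  rw [h, SkewPolynomial.coeff_one, if_neg (by omega)] at h1
  rcases mul_eq_zero.1 h1.symm with h2 | h2
  · exact coeff_natDegree_ne_zero hq0 h2
  · exact coeff_natDegree_ne_zero hp0
      ((map_eq_zero (MulSemiringAction.toRingHom (Multiplicative ℕ) K _)).1 h2)

/-- Otherwise `t^m = t · t^(m-1)` factors into two non-units. -/
lemma ne_zero_of_irreducible_X_pow_sub_C {m : ℕ} (hm : 2 ≤ m) {c : K}
    (h : Irreducible ((X : SkewPolynomial K) ^ m - C c)) : c ≠ 0 := by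
  rintro rfl
  have hX : ∀ k : ℕ, 0 < k → ¬ IsUnit ((X : SkewPolynomial K) ^ k) := by
    intro k hk hu
    obtain ⟨q, hq⟩ := hu.exists_left_inv
    have h1 := natDegree_eq_zero_of_mul_eq_one hq
    have h2 := natDegree_X_pow_sub_C hk (0 : K)
    rw [map_zero, sub_zero] at h2
    omega
  rw [map_zero, sub_zero] at h
  have h1 : (X : SkewPolynomial K) ^ m = X ^ 1 * X ^ (m - 1) := by rw [← pow_add]; congr 1; omega
  rcases h.isUnit_or_isUnit h1 with hu | hu
  · exact hX 1 one_pos hu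
  · exact hX (m - 1) (by omega) hu

/-- A constant monic `h` is `1`, which would give `f` a left inverse. This guarantees a root in an
algebraic closure. -/
lemma IsMclm.natDegree_ne_zero (hφ : ∀ a : K, SkewPolynomial.φ a = σ a) {n : ℕ}
    {f : SkewPolynomial K} (hf : natDegree f ≠ 0) {h : Polynomial F} (hh : IsMclm n f h) :
    h.natDegree ≠ 0 := by
  intro h0
  obtain ⟨hmon, ⟨q, hq⟩, -⟩ := hh
  rw [hmon.natDegree_eq_zero.1 h0, ← evalPowHom_apply hφ, map_one] at hq
  exact hf (natDegree_eq_zero_of_mul_eq_one hq.symm)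

end Skew

end PetitAlg

namespace PetitAlg

/-! ### Substitutions `t ↦ bt` and the induced isomorphisms -/

section Isomorphism

variable {F K : Type*} [Field F] [Field K] [Algebra F K] [MulSemiringAction (Multiplicative ℕ) K]
  {σ : K ≃ₐ[F] K} {ρ : K ≃+* K}

open SkewPolynomial

lemma C_mul_X_pow_eq_monomial_skewNorm (hφ : ∀ a : K, SkewPolynomial.φ a = σ a) (b : K) (i : ℕ) :
    ((C b * X : SkewPolynomial K)) ^ i = monomial i (skewNorm σ i b) := by
  induction i with
  | zero => rw [pow_zero, skewNorm_zero, monomial_zero_one]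
  | succ i ih =>
    have h : (C b * X : SkewPolynomial K) = monomial 1 b := by
      simpa using (C_mul_X_pow_eq_monomial (R := K) (a := b) (n := 1))
    rw [pow_succ, ih, h, monomial_mul_monomial, phi_iterate hφ, skewNorm_succ]

/-- The endomorphism `a ↦ ρ a`, `t ↦ b t` of the skew polynomial ring, where `ρ` commutes
with `σ`. -/
noncomputable def substHom (hφ : ∀ a : K, SkewPolynomial.φ a = σ a)
    (hρ : ∀ a, ρ (σ a) = σ (ρ a)) (b : K) : SkewPolynomial K →+* SkewPolynomial K :=
  SkewMonoidAlgebra.liftNCRingHom (CRingHom.comp (ρ : K →+* K)) (powersHom _ (C b * X)) (by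
    intro x y
    change C (ρ (Multiplicative.ofAdd y.toAdd • x)) * (C b * X) ^ y.toAdd =
      (C b * X) ^ y.toAdd * C (ρ x)
    rw [C_mul_X_pow_eq_monomial_skewNorm hφ, ofAdd_smul hφ, C_mul_monomial, monomial_mul_C,
      phi_iterate hφ, commute_pow_apply hρ, mul_comm])

lemma substHom_monomial (hφ : ∀ a : K, SkewPolynomial.φ a = σ a)
    (hρ : ∀ a, ρ (σ a) = σ (ρ a)) (b : K) (i : ℕ) (a : K) :
    substHom hφ hρ b (monomial i a) = monomial i (ρ a * skewNorm σ i b) := by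
  have h : substHom hφ hρ b (monomial i a) = C (ρ a) * (C b * X) ^ i :=
    SkewMonoidAlgebra.liftNC_single _ _ _ _
  rw [h, C_mul_X_pow_eq_monomial_skewNorm hφ, C_mul_monomial]

lemma substHom_C (hφ : ∀ a : K, SkewPolynomial.φ a = σ a)
    (hρ : ∀ a, ρ (σ a) = σ (ρ a)) (b a : K) : substHom hφ hρ b (C a) = C (ρ a) := by
  rw [← monomial_zero_left, substHom_monomial, skewNorm_zero, mul_one, monomial_zero_left]

lemma coeff_substHom (hφ : ∀ a : K, SkewPolynomial.φ a = σ a)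
    (hρ : ∀ a, ρ (σ a) = σ (ρ a)) (b : K) (p : SkewPolynomial K) (i : ℕ) :
    (substHom hφ hρ b p).coeff i = ρ (p.coeff i) * skewNorm σ i b := by
  induction p using SkewPolynomial.induction with
  | h0 => simp
  | ha n r q _ _ ih =>
    rw [map_add, coeff_add, coeff_add, ih, substHom_monomial, coeff_monomial, coeff_monomial,
      map_add, add_mul]
    split_ifs with h
    · rw [h]
    · simp

lemma substHom_mem_degreeLT (hφ : ∀ a : K, SkewPolynomial.φ a = σ a)
    (hρ : ∀ a, ρ (σ a) = σ (ρ a)) (b : K) {p : SkewPolynomial K} {m : ℕ}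
    (hp : p ∈ degreeLT K m) : substHom hφ hρ b p ∈ degreeLT K m := fun i hi => by
  rw [coeff_substHom, hp i hi, map_zero, zero_mul]

lemma substHom_bijective (hφ : ∀ a : K, SkewPolynomial.φ a = σ a)
    (hρ : ∀ a, ρ (σ a) = σ (ρ a)) {b : K} (hb : b ≠ 0) :
    Function.Bijective (substHom hφ hρ b) := by
  constructor
  · intro p q h
    refine SkewPolynomial.ext fun i => ?_
    have h1 := congrArg (fun x : SkewPolynomial K => x.coeff i) h
    simp only [coeff_substHom] at h1
    exact ρ.injective (mul_right_cancel₀ (skewNorm_ne_zero σ i hb) h1)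
  · intro q
    induction q using SkewPolynomial.induction with
    | h0 => exact ⟨0, map_zero _⟩
    | ha n r q _ _ ih =>
      obtain ⟨p, rfl⟩ := ih
      refine ⟨monomial n (ρ.symm (r * (skewNorm σ n b)⁻¹)) + p, ?_⟩
      rw [map_add, substHom_monomial, RingEquiv.apply_symm_apply, mul_assoc,
        inv_mul_cancel₀ (skewNorm_ne_zero σ n hb), mul_one]

lemma mem_degreeLT_of_substHom_mem (hφ : ∀ a : K, SkewPolynomial.φ a = σ a)
    (hρ : ∀ a, ρ (σ a) = σ (ρ a)) {b : K} (hb : b ≠ 0) {p : SkewPolynomial K} {m : ℕ}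
    (hp : substHom hφ hρ b p ∈ degreeLT K m) : p ∈ degreeLT K m := fun i hi => by
  have h := hp i hi
  rw [coeff_substHom] at h
  exact (map_eq_zero ρ).1 ((mul_eq_zero.1 h).resolve_right (skewNorm_ne_zero σ i hb))

/-- A substitution that maps `f` to a left multiple of `g`, of the same degree as `f`, induces an
isomorphism of Petit algebras. -/
theorem exists_petitAlgebra_ringEquiv (hφ : ∀ a : K, SkewPolynomial.φ a = σ a)
    (hρ : ∀ a, ρ (σ a) = σ (ρ a)) {b : K} (hb : b ≠ 0) {f g : SkewPolynomial K} (hf : f ≠ 0)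
    (hg : g ≠ 0) (hfg : natDegree f = natDegree g) {v : SkewPolynomial K}
    (hv : substHom hφ hρ b f = v * g) :
    ∃ Φ : PetitAlgebra f ≃+* PetitAlgebra g, ∀ (a : K) (x : PetitAlgebra f),
      Φ (a • x) = ρ a • Φ x := by
  have hmem : ∀ x : PetitAlgebra f, substHom hφ hρ b x.val ∈ degreeLT K (natDegree g) :=
    fun x => hfg ▸ substHom_mem_degreeLT hφ hρ b x.val_mem
  -- The substitution turns `p = qf + r` into a division by `g`, because it carries `f` into `Rg`
  -- and does not raise the degree of `r`; remainders are unique.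
  have hrem : ∀ p, rem g (substHom hφ hρ b p) = substHom hφ hρ b (rem f p) := by
    intro p
    obtain ⟨q, hq⟩ := exists_eq_add_rem hf p
    refine rem_eq (q := substHom hφ hρ b q * v) hg (hmem ⟨rem f p, rem_mem f p⟩) ?_
    conv_lhs => rw [hq]
    rw [map_add, map_mul, hv, mul_assoc]
  let Ψ : PetitAlgebra f → PetitAlgebra g := fun x => ⟨substHom hφ hρ b x.val, hmem x⟩
  have hΨ : ∀ x, (Ψ x).val = substHom hφ hρ b x.val := fun _ => rfl
  have hbij : Function.Bijective Ψ := by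
    constructor
    · intro x y hxy
      exact PetitAlgebra.val_injective ((substHom_bijective hφ hρ hb).1
        (congrArg PetitAlgebra.val hxy))
    · intro y
      obtain ⟨p, hp⟩ := (substHom_bijective hφ hρ hb).2 y.val
      have hpm : p ∈ degreeLT K (natDegree f) := by
        refine mem_degreeLT_of_substHom_mem hφ hρ hb ?_
        rw [hp, hfg]
        exact y.val_mem
      exact ⟨⟨p, hpm⟩, PetitAlgebra.val_injective hp⟩
  refine ⟨{ Equiv.ofBijective Ψ hbij with
    map_mul' := fun x y => PetitAlgebra.val_injective ?_
    map_add' := fun x y => PetitAlgebra.val_injective ?_ },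
    fun a x => PetitAlgebra.val_injective (SkewPolynomial.ext fun i => ?_)⟩
  · change (Ψ (x * y)).val = (Ψ x * Ψ y).val
    rw [PetitAlgebra.val_mul, hΨ, hΨ, hΨ, PetitAlgebra.val_mul, ← map_mul, hrem]
  · change (Ψ (x + y)).val = (Ψ x + Ψ y).val
    rw [PetitAlgebra.val_add, hΨ, hΨ, hΨ, PetitAlgebra.val_add, map_add]
  · change (substHom hφ hρ b (a • x).val).coeff i = ρ a * (substHom hφ hρ b x.val).coeff i
    rw [coeff_substHom, coeff_substHom, PetitAlgebra.val_smul, ← mul_assoc, ← map_mul]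
    rfl

/-- The Petit algebras of `t^m - c` and `t^m - d` are isomorphic if `ρ(c)` and `d` differ by a
skew norm of length `m`. -/
theorem exists_petitAlgebra_X_pow_sub_C_ringEquiv (hφ : ∀ a : K, SkewPolynomial.φ a = σ a)
    (hρ : ∀ a, ρ (σ a) = σ (ρ a)) {m : ℕ} (hm : 0 < m) {b c d : K} (hb : b ≠ 0)
    (hcd : ρ c = skewNorm σ m b * d) :
    ∃ Φ : PetitAlgebra (X ^ m - C c : SkewPolynomial K) ≃+*
        PetitAlgebra (X ^ m - C d : SkewPolynomial K),
      ∀ (a : K) (x : PetitAlgebra (X ^ m - C c : SkewPolynomial K)), Φ (a • x) = ρ a • Φ x := by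
  refine exists_petitAlgebra_ringEquiv hφ hρ hb (X_pow_sub_C_ne_zero hm c)
    (X_pow_sub_C_ne_zero hm d) ((natDegree_X_pow_sub_C hm c).trans (natDegree_X_pow_sub_C hm d).symm)
    (v := C (skewNorm σ m b)) ?_
  rw [map_sub, substHom_C, hcd, ← monomial_one_right_eq_X_pow, substHom_monomial, map_one, one_mul,
    mul_sub, C_mul_monomial, mul_one, C_mul]

end Isomorphism

/-! ### Failure of associativity -/

section Associativity

lemma monomial_mem_degreeLT {K : Type*} [Field K] {i m : ℕ} (h : i < m) (a : K) :
    SkewPolynomial.monomial i a ∈ degreeLT K m := fun j hj => by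
  rw [SkewPolynomial.coeff_monomial, if_neg (by omega)]

variable {F K : Type*} [Field F] [Field K] [Algebra F K] [MulSemiringAction (Multiplicative ℕ) K]
  {σ : K ≃ₐ[F] K}

open SkewPolynomial

lemma IsProperNonassociative.of_ringEquiv {A B : Type*} [NonAssocRing A] [NonAssocRing B]
    (h : IsProperNonassociative A) (e : A ≃+* B) : IsProperNonassociative B := fun H =>
  h fun x y z => e.injective (by rw [map_mul, map_mul, map_mul, map_mul, H])

lemma rem_monomial_of_lt {i m : ℕ} (h : i < m) (a c : K) :
    rem ((X : SkewPolynomial K) ^ m - C c) (monomial i a) = monomial i a := by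
  apply rem_of_mem
  rw [natDegree_X_pow_sub_C (by omega)]
  exact monomial_mem_degreeLT h a

lemma rem_monomial_self {m : ℕ} (hm : 0 < m) (a c : K) :
    rem ((X : SkewPolynomial K) ^ m - C c) (monomial m a) = monomial 0 (a * c) := by
  refine rem_eq (q := C a) (X_pow_sub_C_ne_zero hm c) ?_ ?_
  · rw [natDegree_X_pow_sub_C hm]
    exact monomial_mem_degreeLT hm _
  · rw [mul_sub, C_mul_X_pow_eq_monomial, ← C_mul, monomial_zero_left, sub_add_cancel]

/-- If `R/R(t^m - c)` is associative, then `t^m - c` commutes with constants up to `σ^m`. -/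
lemma pow_apply_mul_eq_of_assoc (hφ : ∀ a : K, SkewPolynomial.φ a = σ a) {m : ℕ} (hm : 2 ≤ m)
    {c : K} (h : ¬ IsProperNonassociative (PetitAlgebra (X ^ m - C c : SkewPolynomial K))) (a : K) :
    (σ ^ m) a * c = c * a := by
  have hm1 : m - 1 + 1 = m := by omega
  -- The associator of `t^(m-1)`, `t`, `a` compares `(t^(m-1) t) a = ca` with `t^(m-1) (ta) = σ^m(a)
  -- c`.
  have H := congrArg PetitAlgebra.val (not_not.1 h (PetitAlgebra.mk _ (monomial (m - 1) 1))
    (PetitAlgebra.mk _ (monomial 1 1)) (PetitAlgebra.mk _ (monomial 0 a)))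
  simp only [PetitAlgebra.val_mul, PetitAlgebra.val_mk] at H
  rw [rem_monomial_of_lt (by omega), rem_monomial_of_lt (by omega), rem_monomial_of_lt (by omega),
    monomial_mul_monomial, hm1, rem_monomial_self (by omega), monomial_mul_monomial,
    rem_monomial_of_lt (by omega), monomial_mul_monomial, rem_monomial_of_lt (by omega),
    monomial_mul_monomial, add_zero, hm1, rem_monomial_self (by omega)] at H
  have H1 := monomial_injective 0 H
  simp only [phi_iterate hφ, map_one, one_mul, pow_zero, AlgEquiv.one_apply] at H1
  rw [← AlgEquiv.mul_apply, ← pow_add, hm1] at H1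
  exact H1.symm

/-- If `R/R(t^m - c)` is associative, then `σ` fixes `c`. -/
lemma apply_eq_of_assoc (hφ : ∀ a : K, SkewPolynomial.φ a = σ a) {m : ℕ} (hm : 2 ≤ m)
    {c : K} (h : ¬ IsProperNonassociative (PetitAlgebra (X ^ m - C c : SkewPolynomial K))) :
    σ c = c := by
  have hm1 : m - 1 + 1 = m := by omega
  have hm2 : 1 + (m - 1) = m := by omega
  -- The associator of `t`, `t^(m-1)`, `t` compares `ct` with `tc = σ(c) t`.
  have H := congrArg PetitAlgebra.val (not_not.1 h (PetitAlgebra.mk _ (monomial 1 1))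
    (PetitAlgebra.mk _ (monomial (m - 1) 1)) (PetitAlgebra.mk _ (monomial 1 1)))
  simp only [PetitAlgebra.val_mul, PetitAlgebra.val_mk] at H
  rw [rem_monomial_of_lt (by omega), rem_monomial_of_lt (by omega),
    monomial_mul_monomial, hm2, rem_monomial_self (by omega), monomial_mul_monomial,
    rem_monomial_of_lt (by omega), monomial_mul_monomial, hm1, rem_monomial_self (by omega),
    monomial_mul_monomial, rem_monomial_of_lt (by omega)] at H
  have H1 := monomial_injective 1 H
  simp only [phi_iterate hφ, map_one, one_mul, mul_one, pow_one] at H1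
  exact H1.symm

/-- Associativity would give `σ^m = 1`, although `0 < m` is smaller than the order of `σ`. -/
theorem isProperNonassociative_of_lt [FiniteDimensional F K] [IsGalois F K]
    (hσ : ∀ ρ : K ≃ₐ[F] K, ρ ∈ Subgroup.zpowers σ) (hφ : ∀ a : K, SkewPolynomial.φ a = σ a)
    {m : ℕ} (hm : 2 ≤ m) (hmn : m < Module.finrank F K) {c : K} (hc : c ≠ 0) :
    IsProperNonassociative (PetitAlgebra (X ^ m - C c : SkewPolynomial K)) := by
  by_contra h
  have h1 : σ ^ m = 1 := AlgEquiv.ext fun a => by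
    have h2 := pow_apply_mul_eq_of_assoc hφ hm h a
    rw [mul_comm c] at h2
    exact mul_right_cancel₀ hc h2
  have h2 := Nat.le_of_dvd (by omega) (orderOf_dvd_of_pow_eq_one h1)
  rw [orderOf_eq_card_of_forall_mem_zpowers hσ, IsGalois.card_aut_eq_finrank] at h2
  omega

/-- For `m` equal to the degree, `σ^m = 1` and the previous obstruction disappears. Instead,
associativity puts `c` in the fixed field `F`, and then `F = K` contradicts degree at least `2`. -/
theorem isProperNonassociative_of_forall_mem [FiniteDimensional F K] [IsGalois F K]
    (hσ : ∀ ρ : K ≃ₐ[F] K, ρ ∈ Subgroup.zpowers σ) (hφ : ∀ a : K, SkewPolynomial.φ a = σ a)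
    {m : ℕ} (hm : 2 ≤ m) (hmn : m ≤ Module.finrank F K) {c : K}
    (hc : ∀ E : IntermediateField F K, c ∈ E → E = ⊤) :
    IsProperNonassociative (PetitAlgebra (X ^ m - C c : SkewPolynomial K)) := by
  by_contra h
  have h1 : c ∈ (⊥ : IntermediateField F K) := by
    rw [IsGalois.mem_bot_iff_fixed]
    intro ρ
    have h2 : Subgroup.zpowers σ ≤ MulAction.stabilizer (K ≃ₐ[F] K) c := by
      rw [Subgroup.zpowers_le]
      exact apply_eq_of_assoc hφ hm h
    exact h2 (hσ ρ)
  have h2 := IntermediateField.finrank_top' (F := F) (E := K)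
  rw [← hc _ h1, IntermediateField.finrank_bot] at h2
  omega

end Associativity

end PetitAlg

namespace PetitAlg

/-! ### From an orbit of central multiples to a skew norm relation -/

section Similarity

variable {F K : Type*} [Field F] [Field K] [Algebra F K]

lemma apply_comm_of_mem_autCommuting {σ : K ≃ₐ[F] K} {τ : RingAut K} (hτ : τ ∈ autCommuting σ)
    (a : K) : τ (σ a) = σ (τ a) :=
  (DFunLike.congr_fun (Subgroup.mem_centralizer_singleton_iff.1 hτ) a)

lemma apply_comm_of_forall_mem_zpowers {σ : K ≃ₐ[F] K}
    (hσ : ∀ ρ : K ≃ₐ[F] K, ρ ∈ Subgroup.zpowers σ) (ρ : K ≃ₐ[F] K) (a : K) :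
    ρ (σ a) = σ (ρ a) := by
  obtain ⟨z, rfl⟩ := Subgroup.mem_zpowers_iff.1 (hσ ρ)
  exact DFunLike.congr_fun ((Commute.refl σ).zpow_left z).eq a

/-- A ring automorphism commuting with a generator of the Galois group preserves the base
field. -/
lemma algEquiv_apply_map_algebraMap {σ : K ≃ₐ[F] K}
    (hσ : ∀ ρ : K ≃ₐ[F] K, ρ ∈ Subgroup.zpowers σ) {τ : K ≃+* K}
    (hτ : ∀ a, τ (σ a) = σ (τ a)) (ρ : K ≃ₐ[F] K) (a : F) :
    ρ (τ (algebraMap F K a)) = τ (algebraMap F K a) := by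
  have h : Subgroup.zpowers σ ≤ MulAction.stabilizer (K ≃ₐ[F] K) (τ (algebraMap F K a)) := by
    rw [Subgroup.zpowers_le]
    change σ (τ (algebraMap F K a)) = _
    rw [← hτ, AlgEquiv.commutes]
  exact h (hσ ρ)

/-- If `h` and `s = h^(lam,τ)` divide the polynomials `μ_γ(x^k)` and `μ_δ(x^k)` for the minimal
polynomials `μ_γ` and `μ_δ`, then `lam^k δ` is a conjugate of `τ(γ)`. -/
theorem exists_conj_of_twist [FiniteDimensional F K] [IsGalois F K] {h s : Polynomial F}
    {lam : F} (hlam : lam ≠ 0) {τ : RingAut K}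
    (hs0 : s.natDegree ≠ 0) (horbit : s.map (algebraMap F K) = twist lam τ h) {k : ℕ} {γ δ : K}
    (hγ : h ∣ Polynomial.expand F k (minpoly F γ)) (hδ : s ∣ Polynomial.expand F k (minpoly F δ)) :
    ∃ ρ₁ ρ₂ : K ≃ₐ[F] K, algebraMap F K lam ^ k * ρ₂ δ = τ (ρ₁ γ) := by
  let L := AlgebraicClosure K
  let ι : K →+* L := algebraMap K L
  have hlam' : algebraMap F K lam ≠ 0 := (map_ne_zero _).2 hlam
  obtain ⟨α, hα⟩ : ∃ α : L, s.eval₂ (ι.comp (algebraMap F K)) α = 0 := by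
    apply IsAlgClosed.exists_eval₂_eq_zero
    intro hdeg
    exact hs0 (Polynomial.natDegree_eq_of_degree_eq_some hdeg)
  -- Up to a nonzero constant, `ŝ(x)` is `ĥ^τ(λx)`; here `τ` is moved from the coefficients into the
  -- embedding.
  have hα2 : h.eval₂ ((ι.comp (τ : K →+* K)).comp (algebraMap F K))
      (ι (algebraMap F K lam) * α) = 0 := by
    rw [← Polynomial.eval₂_map, horbit, twist, Polynomial.eval₂_mul, Polynomial.eval₂_C,
      Polynomial.eval₂_comp, Polynomial.eval₂_mul, Polynomial.eval₂_C, Polynomial.eval₂_X,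
      Polynomial.eval₂_map, Polynomial.eval₂_map] at hα
    exact (mul_eq_zero.1 hα).resolve_left ((map_ne_zero ι).2 (pow_ne_zero _ (inv_ne_zero hlam')))
  have hroot : ∀ {p q : Polynomial F} {j : F →+* L} {x : L}, p ∣ Polynomial.expand F k q →
      p.eval₂ j x = 0 → q.eval₂ j (x ^ k) = 0 := by
    intro p q j x hpq hx
    have h1 := Polynomial.eval₂_eq_zero_of_dvd_of_eval₂_eq_zero j x hpq hx
    rwa [Polynomial.expand_eq_comp_X_pow, Polynomial.eval₂_comp, Polynomial.eval₂_X_pow] at h1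
  obtain ⟨ρ₂, h2⟩ := exists_algEquiv_of_eval₂_minpoly ι δ (hroot hδ hα)
  obtain ⟨ρ₁, h1⟩ := exists_algEquiv_of_eval₂_minpoly (ι.comp (τ : K →+* K)) γ (hroot hγ hα2)
  refine ⟨ρ₁, ρ₂, ι.injective ?_⟩
  rw [map_mul, map_pow, ← h2, ← mul_pow, h1]
  rfl

end Similarity

/-- If the minimal central left multiples of `t^m - c` and `t^m - d` are in the same orbit, then
`d` and the image of `c` under an automorphism commuting with `σ` differ by a skew norm. -/
theorem exists_ringEquiv_apply_eq_skewNorm_mul {F K : Type*} [Field F] [Field K] [Algebra F K]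
    [FiniteDimensional F K] [IsGalois F K] {σ : K ≃ₐ[F] K}
    (hσ : ∀ ρ : K ≃ₐ[F] K, ρ ∈ Subgroup.zpowers σ) [MulSemiringAction (Multiplicative ℕ) K]
    (hφ : ∀ a : K, SkewPolynomial.φ a = σ a) {m : ℕ} (hm : 0 < m) {c d : K} (hd : d ≠ 0)
    {h s : Polynomial F}
    (hh : IsMclm (Module.finrank F K) (SkewPolynomial.X ^ m - SkewPolynomial.C c) h)
    (hs : IsMclm (Module.finrank F K) (SkewPolynomial.X ^ m - SkewPolynomial.C d) s)
    {lam : Fˣ} (hlam : lam ∈ normGroup F K) {τ : RingAut K} (hτ : τ ∈ autCommuting σ)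
    (horbit : s.map (algebraMap F K) = twist (lam : F) τ h) :
    ∃ ρ : K ≃+* K, (∀ a, ρ (σ a) = σ (ρ a)) ∧
      (∀ a : F, ρ (algebraMap F K a) = τ (algebraMap F K a)) ∧
      ∃ b : K, b ≠ 0 ∧ ρ c = skewNorm σ m b * d := by
  have hord : orderOf σ = Module.finrank F K := by
    rw [orderOf_eq_card_of_forall_mem_zpowers hσ, IsGalois.card_aut_eq_finrank]
  have hone : σ ^ Module.finrank F K = 1 := hord ▸ pow_orderOf_eq_one σ
  have hr : 0 < orderOf (σ ^ m) := orderOf_pos _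
  -- The order `n` of `σ` divides `mr`, where `r` is the order of `σ^m`.
  obtain ⟨k, hk⟩ : Module.finrank F K ∣ m * orderOf (σ ^ m) := by
    rw [← hord]
    exact orderOf_dvd_of_pow_eq_one (by rw [pow_mul, pow_orderOf_eq_one])
  have hs0 : s.natDegree ≠ 0 :=
    hs.natDegree_ne_zero hφ (by rw [natDegree_X_pow_sub_C hm]; omega)
  obtain ⟨ρ₁, ρ₂, hρ⟩ := exists_conj_of_twist lam.ne_zero hs0 horbit
    (hh.dvd_expand_minpoly hφ hone hk) (hs.dvd_expand_minpoly hφ hone hk)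
  have hτσ := apply_comm_of_mem_autCommuting hτ
  have h₁ := apply_comm_of_forall_mem_zpowers hσ ρ₁
  have h₂ := apply_comm_of_forall_mem_zpowers hσ ρ₂.symm
  -- This solves the conjugacy relation for `δ`. It still commutes with `σ` because the Galois group
  -- is abelian, and it agrees with `τ` on `F` because `τ(F)` is fixed by the Galois group.
  let ρ : K ≃+* K := (ρ₁.toRingEquiv.trans τ).trans ρ₂.symm.toRingEquiv
  have hρa : ∀ a, ρ a = ρ₂.symm (τ (ρ₁ a)) := fun _ => rfl
  have hρσ : ∀ a, ρ (σ a) = σ (ρ a) := fun a => by rw [hρa, hρa, h₁, hτσ, h₂]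
  refine ⟨ρ, hρσ, fun a => ?_, ?_⟩
  · rw [hρa, AlgEquiv.commutes, algEquiv_apply_map_algebraMap hσ hτσ]
  obtain ⟨a, rfl⟩ := hlam
  refine exists_eq_skewNorm_mul σ m hr a.ne_zero hd ?_
  have hpow : ∀ x, ρ ((σ ^ m) x) = (σ ^ m) (ρ x) := commute_pow_apply hρσ m
  -- The `σ^m`-norm of `N_m(a)` is `N_(nk)(a) = N_(K/F)(a)^k = λ^k`, and that of `ρ(c)` is `ρ(γ) =
  -- λ^k δ`.
  rw [skewNorm_mul, skewNorm_pow_skewNorm, hk, skewNorm_mul_of_pow_eq_one hone,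
    skewNorm_finrank hσ, ← map_skewNorm hpow, hρa, ← hρ, map_mul, map_pow, AlgEquiv.commutes,
    AlgEquiv.symm_apply_apply]
  rfl

end PetitAlg

theorem mainTheorem4 {F K : Type*} [Field F] [Field K] [Algebra F K] [FiniteDimensional F K]
    [IsGalois F K]
    -- a generator of the cyclic Galois group
    (σ : K ≃ₐ[F] K) (hσ : ∀ ρ : K ≃ₐ[F] K, ρ ∈ Subgroup.zpowers σ)
    -- `SkewPolynomial K` is the skew polynomial ring `K[t;σ]`
    [MulSemiringAction (Multiplicative ℕ) K] (hφ : ∀ a : K, SkewPolynomial.φ a = σ a)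
    (n m : ℕ) (hn : n = Module.finrank F K) (hm : 2 ≤ m) (hmn : m ≤ n)
    (c d : K) (f g : SkewPolynomial K)
    (hf : f = SkewPolynomial.X ^ m - SkewPolynomial.C c)
    (hg : g = SkewPolynomial.X ^ m - SkewPolynomial.C d)
    (hf_irr : Irreducible f) (hg_irr : Irreducible g)
    (h s : Polynomial F) (hh : PetitAlg.IsMclm n f h) (hs : PetitAlg.IsMclm n g s)
    (hc : (m < n ∧ c ∉ Set.range (algebraMap F K)) ∨
      (n = m ∧ ∀ E : IntermediateField F K, c ∈ E → E = ⊤))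
    (lam : Fˣ) (hlam : lam ∈ PetitAlg.normGroup F K)
    (τ : RingAut K) (hτ : τ ∈ PetitAlg.autCommuting σ)
    (horbit : s.map (algebraMap F K) = PetitAlg.twist (lam : F) τ h) :
    PetitAlg.IsProperNonassociative (PetitAlg.PetitAlgebra f) ∧
    PetitAlg.IsProperNonassociative (PetitAlg.PetitAlgebra g) ∧
    -- a ring isomorphism that is semilinear over `F` with respect to `τ`
    ∃ Φ : PetitAlg.PetitAlgebra f ≃+* PetitAlg.PetitAlgebra g,
      ∀ (a : F) (x : PetitAlg.PetitAlgebra f),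
        Φ (algebraMap F K a • x) = τ (algebraMap F K a) • Φ x := by
  subst hf hg hn
  have hc0 : c ≠ 0 := PetitAlg.ne_zero_of_irreducible_X_pow_sub_C hm hf_irr
  have hd0 : d ≠ 0 := PetitAlg.ne_zero_of_irreducible_X_pow_sub_C hm hg_irr
  obtain ⟨ρ, hρσ, hρF, b, hb, hcd⟩ := PetitAlg.exists_ringEquiv_apply_eq_skewNorm_mul hσ hφ
    (by omega) hd0 hh hs hlam hτ horbit
  obtain ⟨Φ, hΦ⟩ := PetitAlg.exists_petitAlgebra_X_pow_sub_C_ringEquiv hφ hρσ (by omega) hb hcd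
  have hprop : PetitAlg.IsProperNonassociative
      (PetitAlg.PetitAlgebra (SkewPolynomial.X ^ m - SkewPolynomial.C c : SkewPolynomial K)) := by
    rcases hc with ⟨hlt, -⟩ | ⟨-, hE⟩
    · exact PetitAlg.isProperNonassociative_of_lt hσ hφ hm hlt hc0
    · exact PetitAlg.isProperNonassociative_of_forall_mem hσ hφ hm hmn hE
  exact ⟨hprop, hprop.of_ringEquiv Φ, Φ, fun a x => by rw [hΦ, hρF]⟩
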